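/- Fix integers $p,d,r\ge 0$. A function $f$ is cyclically monotone on a set $D\subseteq\mathbb R^r$ if $\sum_{k=1}^{n}\langle x_{k+1},f(x_{k+1})-f(x_k)\rangle\ge 0$ for all $x_1,\dots,x_{n+1}\in D$ with $x_{n+1}=x_1$. Let $X=(X_1^{\mathsf T},\dots,X_p^{\mathsf T})^{\mathsf T}$ be a random vector in $\mathbb R^{dp}$ with $X_j\in\mathbb R^d$. We write $X\sim\mathrm{PCMCG}(\mathcal S,S,\Sigma)$, with $\mathcal S=(\mathcal S_1,\dots,\mathcal S_p)$ and $S=(S_1,\dots,S_p)$, if $\Sigma\in\mathbb R^{dp\times dp}$ is a positive semidefinite matrix whose $d\times d$ diagonal blocks $\Sigma_{jj}$ all equal $I_d$, and for $j=1,\dots,p$ there are an orthogonal matrix $\Gamma_j=(U_j,V_j)\in\mathbb R^{d\times d}$ with $U_j\in\mathbb R^{d\times r}$, $V_j\in\mathbb R^{d\times(d-r)}$ (so $r\le d$ if $p\geq 1$), and a map $T_j:\mathbb R^r\to\mathbb R^r$ that is measurable up to a null set of the law of $U_j^{\mathsf T}X_j$ and cyclically monotone on a set of full measure for that law, such that $$S_j(x)=U_jT_j(U_j^{\mathsf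 T}x)+V_jV_j^{\mathsf T}x,\qquad \mathcal S_j=\operatorname{span}(U_j),\qquad (S_1(X_1)^{\mathsf T},\dots,S_p(X_p)^{\mathsf T})^{\mathsf T}\sim N(0,\Sigma).$$ **Proposition.** Suppose that $X\sim\mathrm{PCMCG}(\mathcal S,S,\Sigma)$ and $\tilde X\sim\mathrm{PCMCG}(\tilde{\mathcal S},\tilde S,\tilde\Sigma)$, with the same $p,d,r$ and possibly defined on different probability spaces, have the same distribution. Then $\Sigma=\tilde\Sigma$, and for every $j$ one has $S_j=\tilde S_j$ almost everywhere with respect to the law of $X_j$. Moreover, for every $j$ such that $\mathcal S_j$ contains no standard Gaussian direction of $X_j$, that is, such that there is no unit vector $v\in\mathcal S_j$ for which $v^{\mathsf T}X_j\sim N(0,1)$ and $v^{\mathsf T}X_j$ is independent of $X_j-(v^{\mathsf T}X_j)v$, one has $\mathcal S_j=\tilde{\mathcal S}_j$. In particular, if this holds for every $j$, then $\mathcal S=\tilde{\mathcal S}$. -/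

import Mathlib

open MeasureTheory ProbabilityTheory

/-- `f` is cyclically monotone on `D`: `∑ₖ ⟨xₖ₊₁, f xₖ₊₁ - f xₖ⟩ ≥ 0` along every finite cycle
`x₀, x₁, …, xₙ = x₀` of points of `D`. -/
def CyclicallyMonotoneOn {E : Type*} [NormedAddCommGroup E] [InnerProductSpace ℝ E]
    (f : E → E) (D : Set E) : Prop :=
  ∀ (n : ℕ) (x : ℕ → E), (∀ k, x k ∈ D) → x n = x 0 →
    0 ≤ ∑ k ∈ Finset.range n, inner ℝ (x (k + 1)) (f (x (k + 1)) - f (x k))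

/-- The map `U ∘ T ∘ Uᵀ + V Vᵀ` of `ℝᵈ`. -/
noncomputable def projectedTransform {d r s : ℕ}
    (U : Matrix (Fin d) (Fin r) ℝ) (V : Matrix (Fin d) (Fin s) ℝ)
    (T : EuclideanSpace ℝ (Fin r) → EuclideanSpace ℝ (Fin r)) :
    EuclideanSpace ℝ (Fin d) → EuclideanSpace ℝ (Fin d) :=
  fun x => U.toEuclideanLin (T (U.transpose.toEuclideanLin x))
    + (V * V.transpose).toEuclideanLin x

/-- `X ∼ PCMCG(𝒮, S, Sg)` with projection dimension `r`, where `X = (X₁, …, X_p)` is a random vector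
in `(ℝᵈ)ᵖ`. The entry of `Sg` at `((j, a), (k, b))` is the entry `(a, b)` of its block `(j, k)`.
The maps `Tⱼ` are determined only up to null sets of the law of `Uⱼᵀ Xⱼ`; accordingly they are asked
to be measurable and cyclically monotone up to such null sets (a map that is cyclically monotone on
all of `ℝʳ` is the case `D = univ`). -/
def IsPCMCG {p d : ℕ} (r : ℕ) {Ω : Type*} [MeasurableSpace Ω]
    (X : Ω → Fin p → EuclideanSpace ℝ (Fin d)) (P : Measure Ω)
    (𝒮 : Fin p → Submodule ℝ (EuclideanSpace ℝ (Fin d)))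
    (S : Fin p → EuclideanSpace ℝ (Fin d) → EuclideanSpace ℝ (Fin d))
    (Sg : Matrix (Fin p × Fin d) (Fin p × Fin d) ℝ) : Prop :=
  AEMeasurable X P ∧
  Sg.PosSemidef ∧
  (∀ j, Sg.submatrix (Prod.mk j) (Prod.mk j) = 1) ∧
  ∃ (T : Fin p → EuclideanSpace ℝ (Fin r) → EuclideanSpace ℝ (Fin r))
    (U : Fin p → Matrix (Fin d) (Fin r) ℝ)
    (V : Fin p → Matrix (Fin d) (Fin (d - r)) ℝ),
    -- `Γⱼ = (Uⱼ, Vⱼ)` is orthogonal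
    (∀ j, ((U j).fromCols (V j)).transpose * (U j).fromCols (V j) = 1 ∧
      (U j).fromCols (V j) * ((U j).fromCols (V j)).transpose = 1) ∧
    (∀ j, AEMeasurable (T j) (P.map fun ω => (U j).transpose.toEuclideanLin (X ω j))) ∧
    (∀ j, ∃ D : Set (EuclideanSpace ℝ (Fin r)), CyclicallyMonotoneOn (T j) D ∧
      ∀ᵐ u ∂(P.map fun ω => (U j).transpose.toEuclideanLin (X ω j)), u ∈ D) ∧
    (∀ j, 𝒮 j = LinearMap.range (U j).toEuclideanLin) ∧
    (∀ j, S j = projectedTransform (U j) (V j) (T j)) ∧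
    HasLaw
      (fun ω => (WithLp.toLp 2 fun ja : Fin p × Fin d => S ja.1 (X ω ja.1) ja.2 :
        EuclideanSpace ℝ (Fin p × Fin d)))
      (multivariateGaussian 0 Sg) P

/-- The random vector `Y` has no standard Gaussian direction inside the subspace `W`: for no unit
vector `v ∈ W` is `⟨v, Y⟩` standard normal and independent of the component of `Y` orthogonal
to `v`. -/
def HasNoGaussianDirection {E : Type*} [NormedAddCommGroup E] [InnerProductSpace ℝ E]
    [MeasurableSpace E] {Ω : Type*} [MeasurableSpace Ω]
    (Y : Ω → E) (P : Measure Ω) (W : Submodule ℝ E) : Prop :=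
  ∀ v ∈ W, ‖v‖ = 1 →
    ¬ (HasLaw (fun ω => inner ℝ v (Y ω)) (gaussianReal 0 1) P ∧
      IndepFun (fun ω => inner ℝ v (Y ω)) (fun ω => Y ω - (inner ℝ v (Y ω) : ℝ) • v) P)

/-! Each `S j` is cyclically monotone almost everywhere and sends the law of `X j` to the standard
Gaussian, so everything rests on Brenier–McCann uniqueness without moment or density assumptions on
the source (`CyclicallyMonotoneOn.ae_eq_of_hasLaw`). The Gaussian has full support, so the image is
dense and Rockafellar's potential `ψ`, built on the target side, is finite everywhere; being convex,
it is differentiable a.e., and `X = ∇ψ(f(X))` almost surely. For a second map `g` with potential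
`χ`, the two subgradient inequalities give `(ψ - χ)(f(X)) ≤ (ψ - χ)(g(X))`. Both sides have the same
law, so they agree; hence `∇ψ(g(X)) = X` too, and `f = g` a.e. Equality of `Sg` and `Sg'` follows by
comparing laws.

If the subspaces differ, equal dimension yields a direction in `𝒮 j` whose coordinate is preserved
by the common transform. Along that direction `ψ` is exactly quadratic, so the rest of `X` depends
only on the orthogonal part of the Gaussian (`CyclicallyMonotoneOn.gaussianDirection`). -/

/-! ### Convex potentials of cyclically monotone maps. -/

section Potential

variable {E : Type*} [NormedAddCommGroup E] [InnerProductSpace ℝ E]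

/-- The convex set of points at which a family of affine functions is bounded above. -/
lemma convex_setOf_bddAbove_affine {ι : Type*} (a : ι → E) (b : ι → ℝ) :
    Convex ℝ {w : E | BddAbove (Set.range fun i => inner ℝ (a i) w + b i)} := by
  rintro u ⟨M, hM⟩ w ⟨N, hN⟩ s t hs ht hst
  refine ⟨s * M + t * N, ?_⟩
  rintro _ ⟨i, rfl⟩
  have h1 : inner ℝ (a i) u + b i ≤ M := hM ⟨i, rfl⟩
  have h2 : inner ℝ (a i) w + b i ≤ N := hN ⟨i, rfl⟩
  have h3 : inner ℝ (a i) (s • u + t • w) + b i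
      = s * (inner ℝ (a i) u + b i) + t * (inner ℝ (a i) w + b i) := by
    rw [inner_add_right, real_inner_smul_right, real_inner_smul_right]
    linear_combination (-b i) * hst
  simp only [h3]
  gcongr

lemma convexOn_iSup_affine {ι : Type*} [Nonempty ι] (a : ι → E) (b : ι → ℝ)
    (h : ∀ w, BddAbove (Set.range fun i => inner ℝ (a i) w + b i)) :
    ConvexOn ℝ Set.univ fun w => ⨆ i, (inner ℝ (a i) w + b i) := by
  refine ⟨convex_univ, fun u _ w _ s t hs ht hst => ciSup_le fun i => ?_⟩
  have h3 : inner ℝ (a i) (s • u + t • w) + b i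
      = s * (inner ℝ (a i) u + b i) + t * (inner ℝ (a i) w + b i) := by
    rw [inner_add_right, real_inner_smul_right, real_inner_smul_right]
    linear_combination (-b i) * hst
  rw [h3, smul_eq_mul, smul_eq_mul]
  gcongr
  · exact le_ciSup (h u) i
  · exact le_ciSup (h w) i

/-- The affine span is closed and dense, so `s` has nonempty interior, and that interior equals the
interior of the closure. -/
lemma Convex.eq_univ_of_dense [FiniteDimensional ℝ E] {s : Set E} (hs : Convex ℝ s)
    (hd : Dense s) : s = Set.univ := by
  have hne : (interior s).Nonempty := by
    rw [hs.interior_nonempty_iff_affineSpan_eq_top, ← AffineSubspace.coe_eq_univ_iff]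
    have hcl : IsClosed (affineSpan ℝ s : Set E) :=
      AffineSubspace.closed_of_finiteDimensional _
    exact Set.eq_univ_of_univ_subset <| hd.closure_eq ▸
      closure_minimal (subset_affineSpan ℝ s) hcl
  have h := hs.interior_closure_eq_interior_of_nonempty_interior hne
  rw [hd.closure_eq, interior_univ] at h
  exact Set.eq_univ_of_univ_subset (h ▸ interior_subset)

/-- A function that is cyclically monotone on `D`, with dense image, has a finite convex potential:
its inverse is contained in a subdifferential. -/
theorem CyclicallyMonotoneOn.exists_convexOn [FiniteDimensional ℝ E] {f : E → E} {D : Set E}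
    (hf : CyclicallyMonotoneOn f D) (hd : Dense (f '' D)) :
    ∃ ψ : E → ℝ, ConvexOn ℝ Set.univ ψ ∧
      ∀ x ∈ D, ∀ w, ψ (f x) + inner ℝ x (w - f x) ≤ ψ w := by
  obtain ⟨x₀, hx₀⟩ : D.Nonempty := hd.nonempty.of_image
  -- Rockafellar's chains, indexed from the free end `a q` back to `x₀`; `c q` is the increment
  -- accumulated from `f x₀` to `f (a q)`.
  let ι := {q : ℕ × (ℕ → E) // (∀ k, q.2 k ∈ D) ∧ q.2 q.1 = x₀}
  let a : ι → E := fun q => q.1.2 0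
  let c : ι → ℝ := fun q =>
    ∑ k ∈ Finset.range q.1.1, inner ℝ (q.1.2 (k + 1)) (f (q.1.2 k) - f (q.1.2 (k + 1)))
  let b : ι → ℝ := fun q => c q - inner ℝ (a q) (f (a q))
  have : Nonempty ι := ⟨⟨(0, fun _ => x₀), fun _ => hx₀, rfl⟩⟩
  have extend (y : E) (hy : y ∈ D) (q : ι) :
      ∃ q' : ι, a q' = y ∧ c q' = c q + inner ℝ (a q) (f y - f (a q)) := by
    refine ⟨⟨(q.1.1 + 1, fun k => Nat.casesOn k y q.1.2), ?_, q.2.2⟩, rfl, ?_⟩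
    · rintro (_ | k)
      · exact hy
      · exact q.2.1 k
    · exact Finset.sum_range_succ' _ _
  have closed (q : ι) : c q + inner ℝ (a q) (f x₀ - f (a q)) ≤ 0 := by
    -- One extra step from `x₀` back to the head of the chain closes the cycle.
    have h := hf (q.1.1 + 1) (fun k => if k ≤ q.1.1 then q.1.2 k else q.1.2 0)
      (fun k => by split_ifs <;> exact q.2.1 _) (by simp)
    rw [Finset.sum_range_succ] at h
    have h2 : ∑ k ∈ Finset.range q.1.1,
        inner ℝ (if k + 1 ≤ q.1.1 then q.1.2 (k + 1) else q.1.2 0)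
          (f (if k + 1 ≤ q.1.1 then q.1.2 (k + 1) else q.1.2 0)
            - f (if k ≤ q.1.1 then q.1.2 k else q.1.2 0)) = - c q := by
      rw [← Finset.sum_neg_distrib]
      refine Finset.sum_congr rfl fun k hk => ?_
      have hk' := Finset.mem_range.1 hk
      rw [if_pos (by omega), if_pos (by omega), ← inner_neg_right, neg_sub]
    simp only [h2, le_refl, if_true, q.2.2] at h
    rw [if_neg (by omega)] at h
    rw [← neg_sub (f (a q)) (f x₀), inner_neg_right]
    simp only [a]
    linarith
  have bdd (w : E) : BddAbove (Set.range fun q => inner ℝ (a q) w + b q) := by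
    -- Prepending `y` and closing the cycle bounds the family at `f y`; convexity spreads this from
    -- the dense image to all of `E`.
    have hu : {w : E | BddAbove (Set.range fun q => inner ℝ (a q) w + b q)} = Set.univ := by
      refine (convex_setOf_bddAbove_affine a b).eq_univ_of_dense (hd.mono ?_)
      rintro _ ⟨y, hy, rfl⟩
      refine ⟨- inner ℝ y (f x₀ - f y), ?_⟩
      rintro _ ⟨q, rfl⟩
      obtain ⟨q', hq', hc⟩ := extend y hy q
      have := closed q'
      rw [hq', hc, inner_sub_right (a q)] at this
      simp only [b]
      linarith
    exact hu.ge (Set.mem_univ w)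
  refine ⟨fun w => ⨆ q, (inner ℝ (a q) w + b q), convexOn_iSup_affine a b bdd, ?_⟩
  intro x hx w
  rw [← le_sub_iff_add_le]
  refine ciSup_le fun q => ?_
  obtain ⟨q', hq', hc⟩ := extend x hx q
  have := le_ciSup (bdd w) q'
  simp only [b, hq', hc] at this ⊢
  rw [inner_sub_right] at this ⊢
  linarith

open scoped Gradient in
lemma gradient_eq_of_isSubgradient [CompleteSpace E] {ψ : E → ℝ} {x z : E}
    (h : ∀ w, ψ z + inner ℝ x (w - z) ≤ ψ w) (hd : DifferentiableAt ℝ ψ z) : ∇ ψ z = x := by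
  have hmin : IsLocalMin (fun w => ψ w - inner ℝ x w) z :=
    Filter.Eventually.of_forall fun w => by
      have := h w
      rw [inner_sub_right] at this
      show ψ z - inner ℝ x z ≤ ψ w - inner ℝ x w
      linarith
  have h0 := hmin.hasFDerivAt_eq_zero
    (hd.hasGradientAt.hasFDerivAt.sub (innerSL ℝ x).hasFDerivAt)
  refine ext_inner_right ℝ fun w => ?_
  have := DFunLike.congr_fun h0 w
  simpa [sub_eq_zero] using this

variable [FiniteDimensional ℝ E] [MeasurableSpace E] [BorelSpace E]

lemma LocallyLipschitz.ae_differentiableAt {F : Type*} [NormedAddCommGroup F] [NormedSpace ℝ F]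
    [FiniteDimensional ℝ F] {g : E → F} (hg : LocallyLipschitz g) (μ : Measure E)
    [μ.IsAddHaarMeasure] : ∀ᵐ z ∂μ, DifferentiableAt ℝ g z := by
  choose K t ht hK using hg
  obtain ⟨s, hs, hcov⟩ := TopologicalSpace.countable_cover_nhds (f := fun x => interior (t x))
    fun x => isOpen_interior.mem_nhds (mem_interior_iff_mem_nhds.2 (ht x))
  have h : ∀ x ∈ s, ∀ᵐ z ∂μ, z ∈ t x → DifferentiableWithinAt ℝ g (t x) z :=
    fun x _ => (hK x).ae_differentiableWithinAt_of_mem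
  filter_upwards [(ae_ball_iff hs).2 h] with z hz
  have hz' : z ∈ ⋃ x ∈ s, interior (t x) := hcov ▸ Set.mem_univ z
  simp only [Set.mem_iUnion] at hz'
  obtain ⟨x, hx, hzx⟩ := hz'
  exact (hz x hx (interior_subset hzx)).differentiableAt (mem_interior_iff_mem_nhds.1 hzx)

end Potential

/-! ### Null sets and support of the standard Gaussian. -/

section StdGaussian

lemma MeasureTheory.Measure.AbsolutelyContinuous.pi_fin {n : ℕ} {α : Type*} [MeasurableSpace α]
    {μ ν : Measure α} [SigmaFinite μ] [SigmaFinite ν] (h : μ ≪ ν) :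
    Measure.pi (fun _ : Fin n => μ) ≪ Measure.pi fun _ : Fin n => ν := by
  induction n with
  | zero =>
    rw [Measure.pi_of_empty, Measure.pi_of_empty]
  | succ n ih =>
    have h1 := (measurePreserving_piFinSuccAbove (fun _ : Fin (n + 1) => μ) 0).symm.map_eq
    have h2 := (measurePreserving_piFinSuccAbove (fun _ : Fin (n + 1) => ν) 0).symm.map_eq
    rw [← h1, ← h2]
    exact (h.prod ih).map (MeasurableEquiv.measurable _)

variable {E : Type*} [NormedAddCommGroup E] [InnerProductSpace ℝ E] [FiniteDimensional ℝ E]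
  [MeasurableSpace E]

lemma stdGaussian_eq_map_stdOrthonormalBasis :
    stdGaussian E = (Measure.pi fun _ : Fin (Module.finrank ℝ E) => gaussianReal 0 1).map
      (fun x => (stdOrthonormalBasis ℝ E).repr.symm (WithLp.toLp 2 x)) := by
  rw [stdGaussian]
  congr 1
  ext x
  rw [← (stdOrthonormalBasis ℝ E).sum_repr_symm]

variable [BorelSpace E]

lemma stdGaussian_absolutelyContinuous_volume : stdGaussian E ≪ (volume : Measure E) := by
  have hmp : MeasurePreserving
      (fun x : Fin (Module.finrank ℝ E) → ℝ =>
        (stdOrthonormalBasis ℝ E).repr.symm (WithLp.toLp 2 x)) volume volume :=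
    (stdOrthonormalBasis ℝ E).measurePreserving_repr_symm.comp
      (PiLp.volume_preserving_toLp _)
  rw [stdGaussian_eq_map_stdOrthonormalBasis, ← hmp.map_eq]
  exact (gaussianReal_absolutelyContinuous 0 one_ne_zero).pi_fin.map hmp.measurable

instance isOpenPosMeasure_gaussianReal : (gaussianReal 0 1).IsOpenPosMeasure :=
  (gaussianReal_absolutelyContinuous' 0 one_ne_zero).isOpenPosMeasure

instance isOpenPosMeasure_stdGaussian : (stdGaussian E).IsOpenPosMeasure := by
  rw [stdGaussian_eq_map_stdOrthonormalBasis]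
  exact Continuous.isOpenPosMeasure_map (by fun_prop)
    ((stdOrthonormalBasis ℝ E).repr.symm.surjective.comp (WithLp.toLp_surjective 2))

end StdGaussian

/-! ### Uniqueness of the cyclically monotone transport. -/

section Brenier

open scoped Gradient

variable {E : Type*} [NormedAddCommGroup E] [InnerProductSpace ℝ E] [FiniteDimensional ℝ E]
  [MeasurableSpace E] [BorelSpace E] {Ω : Type*} [MeasurableSpace Ω] {P : Measure Ω}

lemma measurable_gradient (ψ : E → ℝ) : Measurable (∇ ψ) :=
  (LinearIsometryEquiv.continuous _).measurable.comp (measurable_fderiv ℝ ψ)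

lemma ProbabilityTheory.HasLaw.ae_mem_of_isClosed {Z : Ω → E} (hZ : HasLaw Z (stdGaussian E) P)
    {C : Set E} (hC : IsClosed C) (h : ∀ᵐ ω ∂P, Z ω ∈ C) : C = Set.univ := by
  have h1 : ∀ᵐ z ∂stdGaussian E, z ∈ C :=
    (hZ.ae_iff (p := fun z => z ∈ C) (measurableSet_setOfPred.1 hC.measurableSet)).1 h
  have h2 : Dense C := Measure.dense_of_ae h1
  rw [← h2.closure_eq, hC.closure_eq]

/-- A cyclically monotone map to a standard Gaussian vector is the inverse of the subdifferential
of a finite convex function. -/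
lemma CyclicallyMonotoneOn.exists_convexOn_of_hasLaw {f : E → E} {D : Set E}
    (hf : CyclicallyMonotoneOn f D) {X : Ω → E} (hD : ∀ᵐ ω ∂P, X ω ∈ D)
    (hZ : HasLaw (fun ω => f (X ω)) (stdGaussian E) P) :
    ∃ ψ : E → ℝ, ConvexOn ℝ Set.univ ψ ∧
      (∀ᵐ ω ∂P, ∀ w, ψ (f (X ω)) + inner ℝ (X ω) (w - f (X ω)) ≤ ψ w) ∧
      ∀ᵐ ω ∂P, DifferentiableAt ℝ ψ (f (X ω)) := by
  have hd : Dense (f '' D) := by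
    rw [dense_iff_closure_eq]
    refine hZ.ae_mem_of_isClosed isClosed_closure ?_
    filter_upwards [hD] with ω hω using subset_closure ⟨_, hω, rfl⟩
  obtain ⟨ψ, hψ, h⟩ := hf.exists_convexOn hd
  refine ⟨ψ, hψ, hD.mono fun ω hω => h _ hω, ?_⟩
  refine ae_of_ae_map (f := fun ω => f (X ω)) hZ.aemeasurable ?_
  rw [hZ.map_eq]
  exact stdGaussian_absolutelyContinuous_volume (hψ.locallyLipschitz.ae_differentiableAt volume)

/-- Two random variables with the same law, one of which dominates the other, are equal. -/
lemma ProbabilityTheory.HasLaw.ae_eq_of_ae_le {𝓧 : Type*} [MeasurableSpace 𝓧] {ν : Measure 𝓧}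
    [IsProbabilityMeasure P] {Z Y : Ω → 𝓧} (hZ : HasLaw Z ν P) (hY : HasLaw Y ν P) {h : 𝓧 → ℝ}
    (hh : Measurable h) (hle : ∀ᵐ ω ∂P, h (Z ω) ≤ h (Y ω)) :
    ∀ᵐ ω ∂P, h (Z ω) = h (Y ω) := by
  -- `h` need not be integrable; `arctan` makes it bounded while keeping strict order.
  have hm : Measurable fun z => Real.arctan (h z) := Real.measurable_arctan.comp hh
  have hint (W : Ω → 𝓧) (hW : HasLaw W ν P) : Integrable (fun ω => Real.arctan (h (W ω))) P := by
    refine Integrable.of_bound (hm.comp_aemeasurable hW.aemeasurable).aestronglyMeasurable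
      (Real.pi / 2) (Filter.Eventually.of_forall fun ω => ?_)
    exact abs_le.2 ⟨(Real.neg_pi_div_two_lt_arctan _).le, (Real.arctan_lt_pi_div_two _).le⟩
  have heq : ∫ ω, Real.arctan (h (Z ω)) ∂P = ∫ ω, Real.arctan (h (Y ω)) ∂P :=
    (hZ.integral_comp (f := fun z => Real.arctan (h z)) hm.aestronglyMeasurable).trans
      (hY.integral_comp (f := fun z => Real.arctan (h z)) hm.aestronglyMeasurable).symm
  have := (integral_eq_iff_of_ae_le (hint Z hZ) (hint Y hY)
    (hle.mono fun ω hω => Real.arctan_strictMono.monotone hω)).1 heq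
  exact this.mono fun ω hω => Real.arctan_injective hω

/-- Uniqueness of the cyclically monotone map that sends a given law to the standard Gaussian one;
no moment or regularity assumption is made on the source. -/
theorem CyclicallyMonotoneOn.ae_eq_of_hasLaw [IsProbabilityMeasure P] {f g : E → E} {D D' : Set E}
    (hf : CyclicallyMonotoneOn f D) (hg : CyclicallyMonotoneOn g D') {X : Ω → E}
    (hX : AEMeasurable X P) (hfm : AEMeasurable f (P.map X))
    (hD : ∀ᵐ ω ∂P, X ω ∈ D) (hD' : ∀ᵐ ω ∂P, X ω ∈ D')
    (hZ : HasLaw (fun ω => f (X ω)) (stdGaussian E) P)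
    (hY : HasLaw (fun ω => g (X ω)) (stdGaussian E) P) :
    ∀ᵐ ω ∂P, f (X ω) = g (X ω) := by
  obtain ⟨ψ, hψ, hsub, hdiff⟩ := hf.exists_convexOn_of_hasLaw hD hZ
  obtain ⟨χ, hχ, hsub', -⟩ := hg.exists_convexOn_of_hasLaw hD' hY
  have hdiff' : ∀ᵐ ω ∂P, DifferentiableAt ℝ ψ (g (X ω)) := by
    refine ae_of_ae_map (f := fun ω => g (X ω)) hY.aemeasurable ?_
    rw [hY.map_eq]
    exact stdGaussian_absolutelyContinuous_volume (hψ.locallyLipschitz.ae_differentiableAt volume)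
  have heq := hZ.ae_eq_of_ae_le hY (h := fun z => ψ z - χ z)
    (hψ.locallyLipschitz.continuous.sub hχ.locallyLipschitz.continuous).measurable (by
      filter_upwards [hsub, hsub'] with ω h1 h2
      have h3 := h1 (g (X ω))
      have h4 := h2 (f (X ω))
      rw [← neg_sub, inner_neg_right] at h4
      linarith)
  have hgrad : ∀ᵐ ω ∂P, ∇ ψ (f (X ω)) = X ω := by
    filter_upwards [hsub, hdiff] with ω h1 h2 using gradient_eq_of_isSubgradient h1 h2
  have hgrad' : ∀ᵐ ω ∂P, ∇ ψ (g (X ω)) = X ω := by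
    -- Equality in `heq` makes the subgradient inequality of `ψ` from `f (X ω)` to `g (X ω)` tight,
    -- so `X ω` is also a subgradient at `g (X ω)`.
    filter_upwards [hsub, hsub', hdiff', heq] with ω h1 h2 h3 h4
    refine gradient_eq_of_isSubgradient (fun w => ?_) h3
    have h5 := h2 (f (X ω))
    have h6 := h1 w
    rw [inner_sub_right] at h5 h6 ⊢
    linarith
  have hf' : ∀ᵐ ω ∂P, f (X ω) = hfm.mk f (X ω) := ae_of_ae_map hX hfm.ae_eq_mk
  have hA : Measurable fun z => hfm.mk f (∇ ψ z) = z :=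
    measurableSet_setOfPred.1 <|
      measurableSet_eq_fun (hfm.measurable_mk.comp (measurable_gradient ψ)) measurable_id
  -- That `f` inverts `∇ ψ` is a property of the Gaussian law alone, so it passes from `f (X ω)` to
  -- `g (X ω)`.
  have hA' : ∀ᵐ ω ∂P, hfm.mk f (∇ ψ (g (X ω))) = g (X ω) := by
    refine (hY.ae_iff hA).2 ((hZ.ae_iff hA).1 ?_)
    filter_upwards [hgrad, hf'] with ω h1 h2 using by rw [h1, h2]
  filter_upwards [hA', hgrad', hf'] with ω h1 h2 h3
  rw [h3, ← h1, h2]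

end Brenier

/-! ### Preserved coordinates are Gaussian directions. -/

section GaussianDirection

open scoped Gradient

variable {E : Type*} [NormedAddCommGroup E] [InnerProductSpace ℝ E] [FiniteDimensional ℝ E]
  [MeasurableSpace E] [BorelSpace E] {Ω : Type*} [MeasurableSpace Ω] {P : Measure Ω}

lemma hasLaw_inner_stdGaussian {v : E} (hv : ‖v‖ = 1) :
    HasLaw (fun z : E => inner ℝ v z) (gaussianReal 0 1) (stdGaussian E) where
  map_eq := by
    have h := IsGaussian.map_eq_gaussianReal (μ := stdGaussian E) (innerSL ℝ v)
    rw [integral_strongDual_stdGaussian, variance_dual_stdGaussian, innerSL_apply_norm, hv] at h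
    simpa using h

lemma ProbabilityTheory.HasLaw.indepFun_inner_sub {Z : Ω → E} (hZ : HasLaw Z (stdGaussian E) P)
    {v : E} (hv : ‖v‖ = 1) :
    IndepFun (fun ω => inner ℝ v (Z ω)) (fun ω => Z ω - (inner ℝ v (Z ω) : ℝ) • v) P := by
  let L : E →L[ℝ] ℝ × E :=
    (innerSL ℝ v).prod (ContinuousLinearMap.id ℝ E - (innerSL ℝ v).smulRight v)
  have hL : HasGaussianLaw (fun ω => L (Z ω)) P := hZ.hasGaussianLaw.map_fun L
  refine HasGaussianLaw.indepFun_of_covariance_inner hL fun x y => ?_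
  have h1 : (fun ω => inner ℝ x (inner ℝ v (Z ω))) = (fun z : E => inner ℝ (x • v) z) ∘ Z := by
    ext ω
    simp [real_inner_smul_left, mul_comm]
  have h2 : (fun ω => inner ℝ y (Z ω - (inner ℝ v (Z ω) : ℝ) • v))
      = (fun z : E => inner ℝ (y - (inner ℝ v y : ℝ) • v) z) ∘ Z := by
    ext ω
    simp only [Function.comp_apply, inner_sub_left, inner_sub_right, real_inner_smul_left,
      real_inner_smul_right, real_inner_comm v y]
    ring
  rw [h1, h2, ← covariance_map (by fun_prop) (by fun_prop) hZ.aemeasurable, hZ.map_eq,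
    ← covarianceBilin_apply_eq_cov IsGaussian.memLp_two_id, covarianceBilin_stdGaussian]
  change inner ℝ (x • v) (y - (inner ℝ v y : ℝ) • v) = 0
  simp [inner_sub_right, real_inner_smul_left, real_inner_smul_right, hv, mul_comm]

/-- Exchanging the two points makes the bound two-sided, so increments are quadratically small and
the derivative vanishes. -/
lemma eq_of_forall_sub_sq_le {g : ℝ → ℝ} (h : ∀ t s, g t - s ^ 2 / 2 ≤ g (t + s)) (a b : ℝ) :
    g a = g b := by
  have hd (t : ℝ) : HasDerivAt g 0 t := by
    rw [hasDerivAt_iff_isLittleO]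
    refine Asymptotics.IsBigO.trans_isLittleO (Asymptotics.IsBigO.of_bound 1
      (Filter.Eventually.of_forall fun y => ?_)) (Asymptotics.isLittleO_pow_sub_sub t one_lt_two)
    have h1 := h t (y - t)
    have h2 := h y (t - y)
    rw [add_sub_cancel] at h1 h2
    rw [smul_zero, sub_zero, one_mul, Real.norm_eq_abs, norm_pow, norm_norm, Real.norm_eq_abs (y - t),
      sq_abs, abs_le]
    constructor <;> nlinarith [sq_nonneg (y - t)]
  exact is_const_of_deriv_eq_zero (fun t => (hd t).differentiableAt) (fun t => (hd t).deriv) a b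

/-- If a cyclically monotone map to a standard Gaussian vector preserves the coordinate in the
direction `v`, then `v` is a standard Gaussian direction. -/
theorem CyclicallyMonotoneOn.gaussianDirection {f : E → E} {D : Set E}
    (hf : CyclicallyMonotoneOn f D) {X : Ω → E} (hD : ∀ᵐ ω ∂P, X ω ∈ D)
    (hZ : HasLaw (fun ω => f (X ω)) (stdGaussian E) P) {v : E} (hv : ‖v‖ = 1)
    (hvX : ∀ᵐ ω ∂P, inner ℝ v (f (X ω)) = inner ℝ v (X ω)) :
    HasLaw (fun ω => inner ℝ v (X ω)) (gaussianReal 0 1) P ∧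
      IndepFun (fun ω => inner ℝ v (X ω)) (fun ω => X ω - (inner ℝ v (X ω) : ℝ) • v) P := by
  refine ⟨((hasLaw_inner_stdGaussian hv).fun_comp hZ).congr (hvX.mono fun _ h => h.symm), ?_⟩
  obtain ⟨ψ, hψ, hsub, hdiff⟩ := hf.exists_convexOn_of_hasLaw hD hZ
  have hψc := hψ.locallyLipschitz.continuous
  have hv2 : inner ℝ v v = (1 : ℝ) := by rw [real_inner_self_eq_norm_sq, hv, one_pow]
  -- It holds at almost every value of the Gaussian vector, and it is a closed condition on `z`.
  have hslope (z : E) (s : ℝ) : ψ z + s * inner ℝ v z ≤ ψ (z + s • v) := by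
    have hcl : IsClosed {z : E | ψ z + s * inner ℝ v z ≤ ψ (z + s • v)} :=
      isClosed_le (by fun_prop) (by fun_prop)
    refine (hZ.ae_mem_of_isClosed hcl ?_).ge (Set.mem_univ z)
    filter_upwards [hsub, hvX] with ω h1 h2
    have h3 := h1 (f (X ω) + s • v)
    rw [add_sub_cancel_left, real_inner_smul_right, real_inner_comm, ← h2] at h3
    exact h3
  -- Removing the quadratic part in direction `v` leaves a function constant along `v`.
  let φ : E → ℝ := fun z => ψ z - 2⁻¹ * inner ℝ v z ^ 2
  have hφ (z : E) (t : ℝ) : φ (z + t • v) = φ z := by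
    have := eq_of_forall_sub_sq_le (g := fun t => φ (z + t • v)) (fun t s => ?_) t 0
    · simpa using this
    · have h1 := hslope (z + t • v) s
      rw [add_assoc, ← add_smul] at h1
      simp only [φ, inner_add_right, real_inner_smul_right, hv2] at h1 ⊢
      nlinarith
  have hgrad (z : E) (t : ℝ) : ∇ φ (z + t • v) = ∇ φ z := by
    unfold gradient
    rw [← fderiv_comp_add_right]
    simp only [hφ]
  have hX : ∀ᵐ ω ∂P, X ω - (inner ℝ v (X ω) : ℝ) • v
      = ∇ φ (f (X ω) - (inner ℝ v (f (X ω)) : ℝ) • v) := by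
    filter_upwards [hsub, hdiff, hvX] with ω h1 h2 h3
    rw [sub_eq_add_neg (f (X ω)), ← neg_smul, hgrad, h3.symm]
    have h4 := h2.hasGradientAt.hasFDerivAt
    rw [gradient_eq_of_isSubgradient h1 h2] at h4
    have h5 := h4.sub ((((innerSL ℝ v).hasFDerivAt (x := f (X ω))).pow 2).const_mul 2⁻¹)
    refine (HasGradientAt.gradient (hasGradientAt_iff_hasFDerivAt.2
      (HasFDerivAt.congr_fderiv (f := φ) h5 ?_))).symm
    ext w
    change inner ℝ (X ω) w - 2⁻¹ * ((2 • inner ℝ v (f (X ω)) ^ (2 - 1)) * inner ℝ v w)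
      = inner ℝ (X ω - (inner ℝ v (f (X ω)) : ℝ) • v) w
    rw [inner_sub_left, real_inner_smul_left, nsmul_eq_mul]
    push_cast
    ring
  refine ((hZ.indepFun_inner_sub hv).comp measurable_id (measurable_gradient φ)).congr hvX ?_
  filter_upwards [hX] with ω h using h.symm

end GaussianDirection

/-! ### Algebra of the projected transform. -/

section Blocks

/-- Each term dominates the increment of `‖u‖ ^ 2 / 2`, and these telescope to zero. This handles
the identity acting on the `V` block. -/
lemma sum_inner_sub_nonneg {E : Type*} [NormedAddCommGroup E] [InnerProductSpace ℝ E] (n : ℕ)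
    (u : ℕ → E) (h : u n = u 0) :
    0 ≤ ∑ k ∈ Finset.range n, inner ℝ (u (k + 1)) (u (k + 1) - u k) := by
  have h1 : ∑ k ∈ Finset.range n, (‖u (k + 1)‖ ^ 2 / 2 - ‖u k‖ ^ 2 / 2) = 0 := by
    rw [Finset.sum_range_sub (fun k => ‖u k‖ ^ 2 / 2), h, sub_self]
  rw [← h1]
  refine Finset.sum_le_sum fun k _ => ?_
  have h2 := real_inner_self_nonneg (x := u (k + 1) - u k)
  rw [inner_sub_left, inner_sub_right, inner_sub_right, real_inner_self_eq_norm_sq,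
    real_inner_self_eq_norm_sq, real_inner_comm] at h2
  rw [inner_sub_right, real_inner_self_eq_norm_sq]
  rw [real_inner_comm]
  linarith

lemma Matrix.inner_toEuclideanLin_right {m n : Type*} [Fintype m] [Fintype n] [DecidableEq m]
    [DecidableEq n] (A : Matrix m n ℝ) (x : EuclideanSpace ℝ m) (y : EuclideanSpace ℝ n) :
    inner ℝ x (A.toEuclideanLin y) = inner ℝ (A.transpose.toEuclideanLin x) y := by
  rw [← Matrix.conjTranspose_eq_transpose_of_trivial,
    Matrix.toEuclideanLin_conjTranspose_eq_adjoint, LinearMap.adjoint_inner_left]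

lemma Matrix.toEuclideanLin_mul_apply {l m n : Type*} [Fintype m] [Fintype n] [Fintype l]
    [DecidableEq m] [DecidableEq n] (A : Matrix l m ℝ) (B : Matrix m n ℝ)
    (x : EuclideanSpace ℝ n) :
    (A * B).toEuclideanLin x = A.toEuclideanLin (B.toEuclideanLin x) := by
  simp [Matrix.toLpLin_apply, Matrix.mulVec_mulVec]

variable {d r s : ℕ} (U : Matrix (Fin d) (Fin r) ℝ) (V : Matrix (Fin d) (Fin s) ℝ)
  (T : EuclideanSpace ℝ (Fin r) → EuclideanSpace ℝ (Fin r))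

lemma inner_projectedTransform (w x : EuclideanSpace ℝ (Fin d)) :
    inner ℝ w (projectedTransform U V T x)
      = inner ℝ (U.transpose.toEuclideanLin w) (T (U.transpose.toEuclideanLin x))
        + inner ℝ (V.transpose.toEuclideanLin w) (V.transpose.toEuclideanLin x) := by
  rw [projectedTransform, inner_add_right, Matrix.toEuclideanLin_mul_apply,
    Matrix.inner_toEuclideanLin_right, Matrix.inner_toEuclideanLin_right]

lemma CyclicallyMonotoneOn.projectedTransform {D : Set (EuclideanSpace ℝ (Fin r))}
    (hT : CyclicallyMonotoneOn T D) :
    CyclicallyMonotoneOn (projectedTransform U V T)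
      {x | U.transpose.toEuclideanLin x ∈ D} := by
  intro n x hx hn
  simp_rw [inner_sub_right, inner_projectedTransform, add_sub_add_comm, ← inner_sub_right]
  rw [Finset.sum_add_distrib]
  exact add_nonneg
    (hT n (fun k => U.transpose.toEuclideanLin (x k)) hx (congrArg _ hn))
    (sum_inner_sub_nonneg n (fun k => V.transpose.toEuclideanLin (x k)) (congrArg _ hn))

variable {U V}

/-- The transform preserves the coordinates orthogonal to the range of `U`. -/
lemma inner_projectedTransform_of_mem_orthogonal
    (hUV : U.fromCols V * (U.fromCols V).transpose = 1) {w : EuclideanSpace ℝ (Fin d)}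
    (hw : w ∈ (LinearMap.range U.toEuclideanLin)ᗮ) (x : EuclideanSpace ℝ (Fin d)) :
    inner ℝ w (projectedTransform U V T x) = inner ℝ w x := by
  have h0 : U.transpose.toEuclideanLin w = 0 := ext_inner_right ℝ fun y => by
    rw [← Matrix.inner_toEuclideanLin_right, inner_zero_left, real_inner_comm]
    exact (Submodule.mem_orthogonal _ _).1 hw _ ⟨y, rfl⟩
  rw [Matrix.transpose_fromCols, Matrix.fromCols_mul_fromRows] at hUV
  have h1 : inner ℝ w ((U * U.transpose + V * V.transpose).toEuclideanLin x) = inner ℝ w x := by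
    rw [hUV, Matrix.toLpLin_one, LinearMap.id_apply]
  rw [inner_projectedTransform, ← h1, map_add, LinearMap.add_apply, inner_add_right,
    Matrix.toEuclideanLin_mul_apply, Matrix.toEuclideanLin_mul_apply,
    Matrix.inner_toEuclideanLin_right U, Matrix.inner_toEuclideanLin_right V, h0, inner_zero_left,
    inner_zero_left]

lemma finrank_range_toEuclideanLin
    (hUV : (U.fromCols V).transpose * U.fromCols V = 1) :
    Module.finrank ℝ (LinearMap.range U.toEuclideanLin) = r := by
  have hU : U.transpose * U = 1 := by
    rw [Matrix.transpose_fromCols, Matrix.fromRows_mul_fromCols, ← Matrix.fromBlocks_one,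
      Matrix.fromBlocks_inj] at hUV
    exact hUV.1
  have hinj : Function.Injective U.toEuclideanLin := by
    refine Function.LeftInverse.injective (g := U.transpose.toEuclideanLin) fun y => ?_
    rw [← Matrix.toEuclideanLin_mul_apply, hU, Matrix.toLpLin_one, LinearMap.id_apply]
  rw [LinearMap.finrank_range_of_inj hinj, finrank_euclideanSpace_fin]

end Blocks

/-! ### Marginals of a multivariate Gaussian. -/

section Marginals

lemma multivariateGaussian_map_reindex {ι κ : Type*} [Fintype ι] [DecidableEq ι] [Fintype κ]
    [DecidableEq κ] {S : Matrix ι ι ℝ} (hS : S.PosSemidef) (e : κ → ι) :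
    (multivariateGaussian 0 S).map
      (fun z => (WithLp.toLp 2 fun a => z (e a) : EuclideanSpace ℝ κ))
      = multivariateGaussian 0 (S.submatrix e e) := by
  let L : EuclideanSpace ℝ ι →L[ℝ] EuclideanSpace ℝ κ :=
    (PiLp.continuousLinearEquiv 2 ℝ fun _ : κ => ℝ).symm.toContinuousLinearMap ∘L
      ContinuousLinearMap.pi fun a => EuclideanSpace.proj (e a)
  change (multivariateGaussian 0 S).map L = _
  apply IsGaussian.ext
  · simp only [id_eq, integral_id_multivariateGaussian]
    rw [ContinuousLinearMap.integral_id_map, integral_id_multivariateGaussian, map_zero]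
    exact IsGaussian.integrable_id
  rw [← ContinuousLinearMap.toBilinForm_inj]
  refine LinearMap.BilinForm.ext_basis (EuclideanSpace.basisFun κ ℝ).toBasis fun i j => ?_
  rw [ContinuousLinearMap.toBilinForm_apply, ContinuousLinearMap.toBilinForm_apply,
    covarianceBilin_apply_eq_cov, covariance_map]
  · have (i : κ) : (fun u => inner ℝ ((EuclideanSpace.basisFun κ ℝ).toBasis i) u) ∘ L
        = fun u : EuclideanSpace ℝ ι => u (e i) := by
      ext
      simp [L, PiLp.inner_apply]
    simp_rw [this, covariance_eval_multivariateGaussian hS,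
      covarianceBilin_multivariateGaussian (hS.submatrix _)]
    simp
  any_goals exact Measurable.aestronglyMeasurable (by fun_prop)
  · fun_prop
  · exact IsGaussian.memLp_two_id

end Marginals

/-! ### Consequences of the model for a single block. -/

section PCMCG

variable {p d r : ℕ} {Ω : Type*} [MeasurableSpace Ω] {P : Measure Ω}
  {X : Ω → Fin p → EuclideanSpace ℝ (Fin d)}
  {𝒮 : Fin p → Submodule ℝ (EuclideanSpace ℝ (Fin d))}
  {S : Fin p → EuclideanSpace ℝ (Fin d) → EuclideanSpace ℝ (Fin d)}
  {Sg : Matrix (Fin p × Fin d) (Fin p × Fin d) ℝ}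

namespace IsPCMCG

lemma aemeasurable_apply (h : IsPCMCG r X P 𝒮 S Sg) (j : Fin p) :
    AEMeasurable (fun ω => X ω j) P :=
  (measurable_pi_apply j).comp_aemeasurable h.1

lemma hasLaw (h : IsPCMCG r X P 𝒮 S Sg) :
    HasLaw (fun ω => (WithLp.toLp 2 fun ja : Fin p × Fin d => S ja.1 (X ω ja.1) ja.2 :
      EuclideanSpace ℝ (Fin p × Fin d))) (multivariateGaussian 0 Sg) P := by
  obtain ⟨-, -, -, T, U, V, -, -, -, -, -, h⟩ := h
  exact h

lemma finrank_eq (h : IsPCMCG r X P 𝒮 S Sg) (j : Fin p) : Module.finrank ℝ (𝒮 j) = r := by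
  obtain ⟨-, -, -, T, U, V, hΓ, -, -, h𝒮, -, -⟩ := h
  rw [h𝒮 j, finrank_range_toEuclideanLin (hΓ j).1]

lemma inner_eq_of_mem_orthogonal (h : IsPCMCG r X P 𝒮 S Sg) (j : Fin p)
    {w : EuclideanSpace ℝ (Fin d)} (hw : w ∈ (𝒮 j)ᗮ) (x : EuclideanSpace ℝ (Fin d)) :
    inner ℝ w (S j x) = inner ℝ w x := by
  obtain ⟨-, -, -, T, U, V, hΓ, -, -, h𝒮, hS, -⟩ := h
  rw [h𝒮 j] at hw
  rw [hS j, inner_projectedTransform_of_mem_orthogonal _ (hΓ j).2 hw]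

lemma aemeasurable_transform (h : IsPCMCG r X P 𝒮 S Sg) (j : Fin p) :
    AEMeasurable (S j) (P.map fun ω => X ω j) := by
  have hXj := h.aemeasurable_apply j
  obtain ⟨-, -, -, T, U, V, -, hT, -, -, hS, -⟩ := h
  have hU : Measurable fun x => (U j).transpose.toEuclideanLin x :=
    (LinearMap.continuous_of_finiteDimensional _).measurable
  have hTj : AEMeasurable (T j)
      ((P.map fun ω => X ω j).map fun x => (U j).transpose.toEuclideanLin x) := by
    rw [AEMeasurable.map_map_of_aemeasurable hU.aemeasurable hXj]
    exact hT j
  rw [hS j]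
  exact ((LinearMap.continuous_of_finiteDimensional _).measurable.comp_aemeasurable
    (hTj.comp_measurable hU)).add
      (LinearMap.continuous_of_finiteDimensional _).measurable.aemeasurable

lemma exists_cyclicallyMonotoneOn (h : IsPCMCG r X P 𝒮 S Sg) (j : Fin p) :
    ∃ D, CyclicallyMonotoneOn (S j) D ∧ ∀ᵐ x ∂(P.map fun ω => X ω j), x ∈ D := by
  have hXj := h.aemeasurable_apply j
  obtain ⟨-, -, -, T, U, V, -, -, hD, -, hS, -⟩ := h
  have hU : Measurable fun x => (U j).transpose.toEuclideanLin x :=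
    (LinearMap.continuous_of_finiteDimensional _).measurable
  obtain ⟨D, hTD, hD⟩ := hD j
  rw [hS j]
  refine ⟨_, hTD.projectedTransform (U j) (V j), ae_of_ae_map hU.aemeasurable ?_⟩
  rw [AEMeasurable.map_map_of_aemeasurable hU.aemeasurable hXj]
  exact hD

lemma hasLaw_transform (h : IsPCMCG r X P 𝒮 S Sg) (j : Fin p) :
    HasLaw (S j) (stdGaussian (EuclideanSpace ℝ (Fin d))) (P.map fun ω => X ω j) where
  aemeasurable := h.aemeasurable_transform j
  map_eq := by
    have h1 := multivariateGaussian_map_reindex h.2.1 (Prod.mk j)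
    rw [h.2.2.1 j, multivariateGaussian_zero_one, ← h.hasLaw.map_eq,
      AEMeasurable.map_map_of_aemeasurable (by fun_prop) h.hasLaw.aemeasurable] at h1
    rw [AEMeasurable.map_map_of_aemeasurable (h.aemeasurable_transform j)
      (h.aemeasurable_apply j), ← h1]
    rfl

end IsPCMCG

end PCMCG

theorem mainTheorem7 {p d r : ℕ}
    {Ω Ω' : Type*} [MeasurableSpace Ω] [MeasurableSpace Ω']
    (P : Measure Ω) [IsProbabilityMeasure P] (P' : Measure Ω') [IsProbabilityMeasure P']
    (X : Ω → Fin p → EuclideanSpace ℝ (Fin d)) (X' : Ω' → Fin p → EuclideanSpace ℝ (Fin d))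
    (𝒮 𝒮' : Fin p → Submodule ℝ (EuclideanSpace ℝ (Fin d)))
    (S S' : Fin p → EuclideanSpace ℝ (Fin d) → EuclideanSpace ℝ (Fin d))
    (Sg Sg' : Matrix (Fin p × Fin d) (Fin p × Fin d) ℝ)
    (hX : IsPCMCG r X P 𝒮 S Sg) (hX' : IsPCMCG r X' P' 𝒮' S' Sg')
    (hlaw : IdentDistrib X X' P P') :
    Sg = Sg' ∧
    (∀ j, S j =ᵐ[P.map fun ω => X ω j] S' j) ∧
    (∀ j, HasNoGaussianDirection (fun ω => X ω j) P (𝒮 j) → 𝒮 j = 𝒮' j) := by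
  have hmap (j : Fin p) : P.map (fun ω => X ω j) = P'.map fun ω => X' ω j :=
    (hlaw.comp (measurable_pi_apply j)).map_eq
  have hS (j : Fin p) : S j =ᵐ[P.map fun ω => X ω j] S' j := by
    obtain ⟨D, hD, hD1⟩ := hX.exists_cyclicallyMonotoneOn j
    obtain ⟨D', hD', hD1'⟩ := hX'.exists_cyclicallyMonotoneOn j
    have hY := hX'.hasLaw_transform j
    rw [← hmap j] at hD1' hY
    have := Measure.isProbabilityMeasure_map (hX.aemeasurable_apply j)
    exact hD.ae_eq_of_hasLaw hD' (X := id) aemeasurable_id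
      (by simpa using hX.aemeasurable_transform j) hD1 hD1' (hX.hasLaw_transform j) hY
  have hSX (j : Fin p) : ∀ᵐ ω ∂P, S j (X ω j) = S' j (X ω j) :=
    ae_of_ae_map (hX.aemeasurable_apply j) (hS j)
  refine ⟨?_, hS, fun j hj => ?_⟩
  · have hF : AEMeasurable (fun x : Fin p → EuclideanSpace ℝ (Fin d) =>
        (WithLp.toLp 2 fun ja : Fin p × Fin d => S' ja.1 (x ja.1) ja.2 :
          EuclideanSpace ℝ (Fin p × Fin d))) (P'.map X') := by
      refine (WithLp.measurable_toLp 2 _).comp_aemeasurable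
        (aemeasurable_pi_lambda _ fun ja => ?_)
      have h1 : AEMeasurable (S' ja.1) ((P'.map X').map fun x => x ja.1) := by
        rw [AEMeasurable.map_map_of_aemeasurable (measurable_pi_apply _).aemeasurable hX'.1]
        exact hX'.aemeasurable_transform ja.1
      exact (EuclideanSpace.proj ja.2 (𝕜 := ℝ)).continuous.measurable.comp_aemeasurable
        (h1.comp_measurable (measurable_pi_apply _))
    -- The law of the transform `S'` of `X'` carries over to `X`, where `S'` and `S` agree almost
    -- surely.
    have h2 := HasLaw.comp_of_hasLaw_comp hF ⟨hX'.1, rfl⟩ ⟨hX.1, hlaw.map_eq⟩ hX'.hasLaw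
    have h3 : multivariateGaussian 0 Sg = multivariateGaussian 0 Sg' := by
      rw [← hX.hasLaw.map_eq, ← h2.map_eq]
      refine Measure.map_congr ?_
      filter_upwards [ae_all_iff.2 hSX] with ω hω
      simp only [hω]
    ext a b
    rw [← covariance_eval_multivariateGaussian (μ := 0) hX.2.1, h3,
      covariance_eval_multivariateGaussian hX'.2.1]
  · by_contra hne
    have hnle : ¬ (𝒮' j)ᗮ ≤ (𝒮 j)ᗮ := fun hle =>
      hne <| Submodule.eq_of_le_of_finrank_eq
        ((Submodule.orthogonal_le_orthogonal_iff).1 hle)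
        ((hX.finrank_eq j).trans (hX'.finrank_eq j).symm)
    obtain ⟨w, hw', hw⟩ := SetLike.not_le_iff_exists.1 hnle
    -- `S' j` preserves the `w` coordinate and `S j` that of `w - a`; as the maps agree a.e., the
    -- `a` coordinate is preserved.
    set a := (𝒮 j).starProjection w
    have haS : a ∈ 𝒮 j := Submodule.starProjection_apply_mem _ _
    have hwa : w - a ∈ (𝒮 j)ᗮ := Submodule.sub_starProjection_mem_orthogonal w
    have ha0 : a ≠ 0 := fun h0 => hw (by simpa [h0] using hwa)
    have hnorm : ‖‖a‖⁻¹ • a‖ = 1 := by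
      rw [norm_smul, norm_inv, norm_norm, inv_mul_cancel₀ (norm_ne_zero_iff.2 ha0)]
    obtain ⟨D, hD, hD1⟩ := hX.exists_cyclicallyMonotoneOn j
    refine hj (‖a‖⁻¹ • a) (Submodule.smul_mem _ _ haS) hnorm ?_
    refine hD.gaussianDirection (ae_of_ae_map (hX.aemeasurable_apply j) hD1)
      ((hX.hasLaw_transform j).fun_comp ⟨hX.aemeasurable_apply j, rfl⟩) hnorm ?_
    filter_upwards [hSX j] with ω hω
    have h1 := hX.inner_eq_of_mem_orthogonal j hwa (X ω j)
    have h2 := hX'.inner_eq_of_mem_orthogonal j hw' (X ω j)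
    rw [← hω] at h2
    rw [inner_sub_left, inner_sub_left] at h1
    rw [real_inner_smul_left, real_inner_smul_left]
    congr 1
    linarith
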